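/- Let $\nu$ be a positive integer and let $\mathcal A$ be the Fermion (CAR) algebra over the lattice $\mathbb Z^\nu$: a unital $C^*$-algebra containing elements $a_i$ ($i\in\mathbb Z^\nu$) with $$a_i^*a_j+a_ja_i^*=\delta_{i,j}\mathbf 1,\qquad a_ia_j+a_ja_i=a_i^*a_j^*+a_j^*a_i^*=0\qquad(i,j\in\mathbb Z^\nu),$$ and generated as a $C^*$-algebra by them. For $I\subset\mathbb Z^\nu$ let $\mathcal A(I)$ be the unital $C^*$-subalgebra generated by $a_i$, $a_i^*$, $i\in I$ (so $\mathcal A(\emptyset)=\mathbb C\mathbf 1$), let $\mathcal A(I)'$ be its commutant, and put $I^c=\mathbb Z^\nu\setminus I$. Let $\Theta$ be the unique $*$-automorphism of $\mathcal A$ with $\Theta(a_i)=-a_i$ for all $i\in\mathbb Z^\nu$, and let $$\mathcal A(I)_{\pm}=\{x\in\mathcal A(I):\Theta(x)=\pm x\}.$$ (1) For every finite $I\subset\mathbb Z^\nu$, $$\mathcal A(I)'\cap\mathcal A=\mathcal A(I^c)_++v_I\,\mathcal A(I^c)_-,\qquad v_I=\prod_{i\in I}(a_i^*a_i-a_ia_i^*)$$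 (the factors of $v_I$ commute; $v_\emptyset=\mathbf 1$). (2) For every infinite $I\subset\mathbb Z^\nu$, $$\mathcal A(I)'\cap\mathcal A=\mathcal A(I^c)_+ .$$ -/

import Mathlib

open Filter Topology
open scoped Pointwise

/-- The Fermion (CAR) `C⋆`-algebra over the lattice `ℤ^ν`: a unital `C⋆`-algebra `A` with elements
`a i`, `i ∈ ℤ^ν`, satisfying the canonical anticommutation relations and such that the `⋆`-algebra
generated by all `a i` (and their adjoints) is norm dense in `A`. -/
structure FermionAlgebra (ν : ℕ) (A : Type*) [CStarAlgebra A] where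
  /-- the annihilation operators; the creation operators are `star (a i)` -/
  a : (Fin ν → ℤ) → A
  car_star : ∀ i j, star (a i) * a j + a j * star (a i) = if i = j then 1 else 0
  car_ann : ∀ i j, a i * a j + a j * a i = 0
  car_cre : ∀ i j, star (a i) * star (a j) + star (a j) * star (a i) = 0
  generates : (StarAlgebra.adjoin ℂ (Set.range a)).topologicalClosure = ⊤

namespace FermionAlgebra

variable {ν : ℕ} {A : Type*} [CStarAlgebra A] (F : FermionAlgebra ν A)

/-- The `C⋆`-subalgebra `A(I)` generated by `a i`, `star (a i)`, `i ∈ I`. For `I = ∅` this is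
`ℂ 1`. -/
noncomputable def localAlgebra (I : Set (Fin ν → ℤ)) : StarSubalgebra ℂ A :=
  (StarAlgebra.adjoin ℂ (F.a '' I)).topologicalClosure

/-- `v_i = a_i^* a_i - a_i a_i^*`. -/
def vSite (i : Fin ν → ℤ) : A := star (F.a i) * F.a i - F.a i * star (F.a i)

theorem ann_sq (i : Fin ν → ℤ) : F.a i * F.a i = 0 := by
  have h := F.car_ann i i
  rw [← two_smul ℂ] at h
  exact (smul_eq_zero.1 h).resolve_left two_ne_zero

theorem vSite_star (i : Fin ν → ℤ) : star (F.vSite i) = F.vSite i := by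
  simp [vSite]

theorem vSite_mul_self (i : Fin ν → ℤ) : F.vSite i * F.vSite i = 1 := by
  have h0 := F.ann_sq i
  have h2 : star (F.a i) * star (F.a i) = 0 := by rw [← star_mul, h0, star_zero]
  have h1 := F.car_star i i
  simp only [if_true] at h1
  have h3 : F.vSite i * F.vSite i =
      (star (F.a i) * F.a i + F.a i * star (F.a i)) * (star (F.a i) * F.a i + F.a i * star (F.a i))
      - 2 * (star (F.a i) * (F.a i * F.a i) * star (F.a i))
      - 2 * (F.a i * (star (F.a i) * star (F.a i)) * F.a i) := by
    unfold vSite; noncomm_ring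
  rw [h3, h1, h0, h2]; simp

theorem vSite_anti (i : Fin ν → ℤ) : F.vSite i * F.a i = -(F.a i * F.vSite i) := by
  have h0 : F.vSite i * F.a i + F.a i * F.vSite i =
      star (F.a i) * (F.a i * F.a i) - (F.a i * F.a i) * star (F.a i) := by
    unfold vSite; noncomm_ring
  rw [F.ann_sq, mul_zero, zero_mul, sub_zero] at h0
  exact eq_neg_of_add_eq_zero_left h0

theorem vSite_comm_ann {i j : Fin ν → ℤ} (h : i ≠ j) : Commute (F.vSite i) (F.a j) := by
  have h1 := F.car_star i j
  have h2 := F.car_ann i j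
  simp only [h, if_false] at h1
  have h3 : F.vSite i * F.a j - F.a j * F.vSite i =
      star (F.a i) * (F.a i * F.a j + F.a j * F.a i)
      - (star (F.a i) * F.a j + F.a j * star (F.a i)) * F.a i
      - F.a i * (star (F.a i) * F.a j + F.a j * star (F.a i))
      + (F.a i * F.a j + F.a j * F.a i) * star (F.a i) := by
    unfold vSite; noncomm_ring
  rw [h1, h2] at h3
  exact sub_eq_zero.1 (by simpa using h3)

theorem vSite_comm {i j : Fin ν → ℤ} (h : i ≠ j) : Commute (F.vSite i) (F.vSite j) := by
  have h1 := F.vSite_comm_ann h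
  have h2 : Commute (F.vSite i) (star (F.a j)) := by
    have := h1.star_star
    rwa [vSite_star] at this
  exact (h2.mul_right h1).sub_right (h1.mul_right h2)

/-- `v_I = ∏_{i ∈ I} v_i` for a finite set `I` (the factors commute). -/
def v (I : Finset (Fin ν → ℤ)) : A :=
  I.noncommProd F.vSite fun _ _ _ _ h => F.vSite_comm h

theorem v_insert {i : Fin ν → ℤ} {I : Finset (Fin ν → ℤ)} (h : i ∉ I) :
    F.v (insert i I) = F.vSite i * F.v I :=
  Finset.noncommProd_insert_of_notMem _ _ _ _ h

theorem v_comm_ann {i : Fin ν → ℤ} {I : Finset (Fin ν → ℤ)} (h : i ∉ I) :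
    Commute (F.v I) (F.a i) :=
  (Finset.noncommProd_commute _ _ _ _ fun _ hj =>
    (F.vSite_comm_ann (ne_of_mem_of_not_mem hj h)).symm).symm

theorem vSite_comm_v {i : Fin ν → ℤ} {I : Finset (Fin ν → ℤ)} (h : i ∉ I) :
    Commute (F.vSite i) (F.v I) :=
  Finset.noncommProd_commute _ _ _ _ fun _ hj =>
    F.vSite_comm (ne_of_mem_of_not_mem hj h).symm

theorem v_star_and_sq (I : Finset (Fin ν → ℤ)) : star (F.v I) = F.v I ∧ F.v I * F.v I = 1 := by
  induction I using Finset.induction_on with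
  | empty =>
    have h : F.v ∅ = 1 := Finset.noncommProd_empty _ _
    simp [h]
  | insert i I hi ih =>
    have hc := F.vSite_comm_v hi
    have hs := F.vSite_mul_self i
    rw [F.v_insert hi]
    refine ⟨?_, ?_⟩
    · rw [star_mul, ih.1, F.vSite_star, hc.eq]
    · have h2 := ih.2
      have h3 := hc.eq
      grind

theorem v_anti {i : Fin ν → ℤ} {I : Finset (Fin ν → ℤ)} (h : i ∈ I) :
    F.v I * F.a i * F.v I = -F.a i := by
  have hi : i ∉ I.erase i := Finset.notMem_erase i I
  have h1 : F.v I = F.vSite i * F.v (I.erase i) := by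
    rw [← F.v_insert hi, Finset.insert_erase h]
  have h2 := (F.v_star_and_sq I).2
  have h3 : F.v I * F.a i = -(F.a i * F.v I) := by
    rw [h1, mul_assoc, (F.v_comm_ann hi).eq, ← mul_assoc, F.vSite_anti, neg_mul, mul_assoc]
  rw [h3, neg_mul, mul_assoc, h2, mul_one]

theorem norm_conj_v (I : Finset (Fin ν → ℤ)) (x : A) : ‖F.v I * x * F.v I‖ = ‖x‖ := by
  obtain ⟨h1, h2⟩ := F.v_star_and_sq I
  have hu : F.v I ∈ unitary A := by
    rw [Unitary.mem_iff, h1]; exact ⟨h2, h2⟩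
  rw [CStarRing.norm_mul_mem_unitary _ hu, CStarRing.norm_mem_unitary_mul _ hu]

theorem exists_tendsto (x : A) :
    ∃ y, Tendsto (fun I : Finset (Fin ν → ℤ) => F.v I * x * F.v I) atTop (𝓝 y) := by
  have hx : x ∈ closure (StarAlgebra.adjoin ℂ (Set.range F.a) : Set A) := by
    rw [← StarSubalgebra.topologicalClosure_coe, F.generates]; trivial
  have key : ∀ z ∈ StarAlgebra.adjoin ℂ (Set.range F.a),
      ∃ y, Tendsto (fun I : Finset (Fin ν → ℤ) => F.v I * z * F.v I) atTop (𝓝 y) := by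
    intro z hz
    induction hz using StarAlgebra.adjoin_induction with
    | mem z hz =>
      obtain ⟨i, rfl⟩ := hz
      refine ⟨-F.a i, tendsto_const_nhds.congr' ?_⟩
      filter_upwards [eventually_ge_atTop {i}] with I hI
      exact (F.v_anti (hI (Finset.mem_singleton_self i))).symm
    | algebraMap r =>
      refine ⟨algebraMap ℂ A r, tendsto_const_nhds.congr fun I => ?_⟩
      rw [← Algebra.commutes, mul_assoc, (F.v_star_and_sq I).2, mul_one]
    | add z w _ _ h1 h2 =>
      obtain ⟨y1, h1⟩ := h1
      obtain ⟨y2, h2⟩ := h2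
      exact ⟨_, (h1.add h2).congr fun I => by simp [mul_add, add_mul]⟩
    | mul z w _ _ h1 h2 =>
      obtain ⟨y1, h1⟩ := h1
      obtain ⟨y2, h2⟩ := h2
      refine ⟨_, (h1.mul h2).congr fun I => ?_⟩
      have := (F.v_star_and_sq I).2
      grind
    | star z _ h1 =>
      obtain ⟨y1, h1⟩ := h1
      exact ⟨_, h1.star.congr fun I => by simp [(F.v_star_and_sq I).1, mul_assoc]⟩
  apply cauchySeq_tendsto_of_complete
  rw [Metric.cauchySeq_iff']
  intro ε hε
  obtain ⟨z, hz, hxz⟩ := Metric.mem_closure_iff.1 hx (ε / 3) (by positivity)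
  obtain ⟨y, hy⟩ := key z hz
  obtain ⟨N, hN⟩ := Metric.cauchySeq_iff'.1 hy.cauchySeq (ε / 3) (by positivity)
  refine ⟨N, fun n hn => ?_⟩
  have hd : ∀ I : Finset (Fin ν → ℤ),
      dist (F.v I * x * F.v I) (F.v I * z * F.v I) = dist x z := fun I => by
    rw [dist_eq_norm, dist_eq_norm, ← F.norm_conj_v I (x - z), mul_sub, sub_mul]
  have h1 := hd n
  have h2 := hd N
  have h3 := hN n hn
  have h4 := dist_triangle4 (F.v n * x * F.v n) (F.v n * z * F.v n)
    (F.v N * z * F.v N) (F.v N * x * F.v N)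
  rw [dist_comm (F.v N * z * F.v N)] at h4
  linarith

open scoped CStarAlgebra in
theorem hom_ext {f g : A →⋆ₐ[ℂ] A} (h : ∀ i, f (F.a i) = g (F.a i)) : f = g := by
  have hf : Continuous f := map_continuous f
  have hg : Continuous g := map_continuous g
  have hle : StarAlgebra.adjoin ℂ (Set.range F.a) ≤ StarAlgHom.equalizer f g := by
    rw [StarAlgebra.adjoin_le_iff]
    rintro _ ⟨i, rfl⟩
    exact h i
  have hcl : IsClosed (StarAlgHom.equalizer f g : Set A) := isClosed_eq hf hg
  have := StarSubalgebra.topologicalClosure_minimal hle hcl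
  rw [F.generates] at this
  ext x
  exact this (Set.mem_univ x : x ∈ (⊤ : StarSubalgebra ℂ A))

/-- The grading automorphism exists and is unique. -/
theorem existsUnique_theta : ∃! Θ : A ≃⋆ₐ[ℂ] A, ∀ i, Θ (F.a i) = -F.a i := by
  choose f hf using F.exists_tendsto
  let φ : A →⋆ₐ[ℂ] A :=
    { toFun := f
      map_one' := tendsto_nhds_unique (hf 1) (tendsto_const_nhds.congr fun I => by
        rw [mul_one, (F.v_star_and_sq I).2])
      map_mul' := fun x y => tendsto_nhds_unique (hf (x * y)) <|
        ((hf x).mul (hf y)).congr fun I => by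
          have := (F.v_star_and_sq I).2
          grind
      map_zero' := tendsto_nhds_unique (hf 0) (tendsto_const_nhds.congr fun I => by simp)
      map_add' := fun x y => tendsto_nhds_unique (hf (x + y)) <|
        ((hf x).add (hf y)).congr fun I => by simp [mul_add, add_mul]
      commutes' := fun r => tendsto_nhds_unique (hf _) (tendsto_const_nhds.congr fun I => by
        rw [← Algebra.commutes, mul_assoc, (F.v_star_and_sq I).2, mul_one])
      map_star' := fun x => tendsto_nhds_unique (hf _) <| (hf x).star.congr fun I => by
        simp [(F.v_star_and_sq I).1, mul_assoc] }
  have hφ : ∀ i, φ (F.a i) = -F.a i := fun i =>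
    tendsto_nhds_unique (hf (F.a i)) <| tendsto_const_nhds.congr' <| by
      filter_upwards [eventually_ge_atTop {i}] with I hI
      exact (F.v_anti (hI (Finset.mem_singleton_self i))).symm
  have hφφ : φ.comp φ = StarAlgHom.id ℂ A := F.hom_ext fun i => by simp [hφ]
  refine ⟨StarAlgEquiv.ofStarAlgHom φ φ hφφ hφφ, fun i => hφ i, fun Θ hΘ => ?_⟩
  have h := F.hom_ext (f := (Θ : A →⋆ₐ[ℂ] A)) (g := φ) fun i => (hΘ i).trans (hφ i).symm
  ext x
  exact congrArg (fun g : A →⋆ₐ[ℂ] A => g x) h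

/-- The unique `⋆`-automorphism `Θ` of `A` with `Θ (a i) = -a i` for all `i`. -/
noncomputable def theta : A ≃⋆ₐ[ℂ] A := F.existsUnique_theta.choose

theorem theta_ann (i : Fin ν → ℤ) : F.theta (F.a i) = -F.a i :=
  F.existsUnique_theta.choose_spec.1 i

/-- `A(I)_+`, the `Θ`-even part of `A(I)`. -/
def evenPart (I : Set (Fin ν → ℤ)) : Set A := {x | x ∈ F.localAlgebra I ∧ F.theta x = x}

/-- `A(I)_-`, the `Θ`-odd part of `A(I)`. -/
def oddPart (I : Set (Fin ν → ℤ)) : Set A := {x | x ∈ F.localAlgebra I ∧ F.theta x = -x}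

end FermionAlgebra

/-! The proof rests on a graded commutant. An element `x` graded-commutes with a site `i` if moving
`a i` or its adjoint past `x` replaces `x` by `Θ x`. The CAR give this for every `x` in `A(J)` with
`i ∉ J` (`gradedCommute_of_mem_localAlgebra`). Conversely, an `x` graded-commuting with all sites of
`I` lies in `A(Iᶜ)` (`mem_localAlgebra_compl_of_gradedCommute`): approximate `x` by elements of
finite support and average out the sites in `I` by contractions that fix `x`.

On even elements graded commutation is commutation. For finite `I`, split `x` in the commutant into
even and odd parts; multiplying the odd part by `v_I`, which anticommutes with each `a i`, `i ∈ I`,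
turns commutation into graded commutation. For infinite `I` there is no odd part
(`theta_eq_self_of_mem_centralizer`), since far from the support of an approximant `Θ` is
implemented by a unitary of `A(I)`. -/

namespace FermionAlgebra

variable {ν : ℕ} {A : Type*} [CStarAlgebra A] (F : FermionAlgebra ν A)

/-! ### The grading and the local algebras -/

theorem theta_star_ann (i : Fin ν → ℤ) : F.theta (star (F.a i)) = -star (F.a i) := by
  rw [map_star, theta_ann, star_neg]

theorem theta_theta (x : A) : F.theta (F.theta x) = x := by
  have h := F.hom_ext (f := ((F.theta : A →⋆ₐ[ℂ] A)).comp (F.theta : A →⋆ₐ[ℂ] A))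
    (g := StarAlgHom.id ℂ A) fun i => by
      change F.theta (F.theta (F.a i)) = F.a i
      rw [theta_ann, map_neg, theta_ann, neg_neg]
  exact congrArg (fun g : A →⋆ₐ[ℂ] A => g x) h

theorem norm_theta (x : A) : ‖F.theta x‖ = ‖x‖ :=
  StarAlgEquiv.norm_map F.theta x

theorem continuous_theta : Continuous F.theta :=
  (AddMonoidHomClass.isometry_of_norm F.theta F.norm_theta).continuous

theorem theta_vSite (i : Fin ν → ℤ) : F.theta (F.vSite i) = F.vSite i := by
  simp [vSite, theta_ann, theta_star_ann]

theorem theta_v (I : Finset (Fin ν → ℤ)) : F.theta (F.v I) = F.v I := by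
  induction I using Finset.induction_on with
  | empty =>
    have h : F.v ∅ = 1 := Finset.noncommProd_empty _ _
    rw [h, map_one]
  | insert i I hi ih => rw [F.v_insert hi, map_mul, theta_vSite, ih]

/-- `K` need not be closed under `star`, because the subalgebras used below are not visibly so;
hence the separate check on the adjoints of the generators. -/
theorem localAlgebra_subset_of_isClosed {I : Set (Fin ν → ℤ)} {K : Subalgebra ℂ A}
    (hK : IsClosed (K : Set A)) (h : ∀ i ∈ I, F.a i ∈ K) (hs : ∀ i ∈ I, star (F.a i) ∈ K) {x : A}
    (hx : x ∈ F.localAlgebra I) : x ∈ K := by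
  have hle : (StarAlgebra.adjoin ℂ (F.a '' I)).toSubalgebra ≤ K := by
    rw [StarAlgebra.adjoin_toSubalgebra, Algebra.adjoin_le_iff]
    rintro y (⟨i, hi, rfl⟩ | ⟨i, hi, h2⟩)
    · exact h i hi
    · rw [← star_star y, ← h2]
      exact hs i hi
  exact closure_minimal (fun y hy => hle hy) hK hx

theorem ann_mem_localAlgebra {I : Set (Fin ν → ℤ)} {i : Fin ν → ℤ} (hi : i ∈ I) :
    F.a i ∈ F.localAlgebra I :=
  StarSubalgebra.le_topologicalClosure _ (StarAlgebra.subset_adjoin _ _ ⟨i, hi, rfl⟩)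

theorem isClosed_localAlgebra (I : Set (Fin ν → ℤ)) : IsClosed (F.localAlgebra I : Set A) :=
  StarSubalgebra.isClosed_topologicalClosure _

theorem localAlgebra_mono {I J : Set (Fin ν → ℤ)} (h : I ⊆ J) :
    F.localAlgebra I ≤ F.localAlgebra J :=
  StarSubalgebra.topologicalClosure_mono (StarAlgebra.adjoin_mono (Set.image_mono h))

theorem mem_centralizer_localAlgebra_iff {I : Set (Fin ν → ℤ)} {x : A} :
    x ∈ Set.centralizer (F.localAlgebra I : Set A) ↔
      ∀ i ∈ I, F.a i * x = x * F.a i ∧ star (F.a i) * x = x * star (F.a i) := by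
  refine ⟨fun h i hi => ⟨h _ (F.ann_mem_localAlgebra hi),
    h _ (star_mem (F.ann_mem_localAlgebra hi))⟩, fun h y hy => ?_⟩
  have hc : IsClosed (Subalgebra.centralizer ℂ {x} : Set A) := by
    rw [Subalgebra.coe_centralizer]
    exact Set.isClosed_centralizer _
  have := F.localAlgebra_subset_of_isClosed hc
    (fun i hi => Subalgebra.mem_centralizer_iff ℂ |>.2 (by simpa using (h i hi).1.symm))
    (fun i hi => Subalgebra.mem_centralizer_iff ℂ |>.2 (by simpa using (h i hi).2.symm)) hy
  exact ((Subalgebra.mem_centralizer_iff ℂ).1 this x rfl).symm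

/-! ### Graded commutation with a site -/

/-- `x` graded-commutes with `a i` and its adjoint. -/
def GradedCommute (i : Fin ν → ℤ) (x : A) : Prop :=
  F.a i * x = F.theta x * F.a i ∧ star (F.a i) * x = F.theta x * star (F.a i)

theorem ann_mul_ann (i j : Fin ν → ℤ) : F.a i * F.a j = -(F.a j * F.a i) :=
  eq_neg_of_add_eq_zero_left (F.car_ann i j)

theorem cre_mul_cre (i j : Fin ν → ℤ) :
    star (F.a i) * star (F.a j) = -(star (F.a j) * star (F.a i)) :=
  eq_neg_of_add_eq_zero_left (F.car_cre i j)

theorem cre_mul_ann {i j : Fin ν → ℤ} (h : i ≠ j) :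
    star (F.a i) * F.a j = -(F.a j * star (F.a i)) :=
  eq_neg_of_add_eq_zero_left (by rw [F.car_star, if_neg h])

theorem ann_mul_cre {i j : Fin ν → ℤ} (h : i ≠ j) :
    F.a i * star (F.a j) = -(star (F.a j) * F.a i) := by
  rw [F.cre_mul_ann h.symm, neg_neg]

/-- As `Θ` is a continuous homomorphism, graded commutation with `i` cuts out a closed subalgebra,
so the CAR on generators suffice. -/
theorem gradedCommute_of_mem_localAlgebra {J : Set (Fin ν → ℤ)} {i : Fin ν → ℤ} (hi : i ∉ J)
    {x : A} (hx : x ∈ F.localAlgebra J) : F.GradedCommute i x := by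
  let K : Subalgebra ℂ A :=
    { carrier := {x | F.GradedCommute i x}
      mul_mem' := fun {x y} hx hy => by
        refine ⟨?_, ?_⟩
        · rw [← mul_assoc, hx.1, mul_assoc, hy.1, map_mul, mul_assoc]
        · rw [← mul_assoc, hx.2, mul_assoc, hy.2, map_mul, mul_assoc]
      add_mem' := fun {x y} hx hy => by
        refine ⟨?_, ?_⟩
        · rw [mul_add, hx.1, hy.1, map_add, add_mul]
        · rw [mul_add, hx.2, hy.2, map_add, add_mul]
      algebraMap_mem' := fun r => by
        have h : F.theta (algebraMap ℂ A r) = algebraMap ℂ A r := by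
          rw [Algebra.algebraMap_eq_smul_one, map_smul, map_one]
        exact ⟨by rw [h, Algebra.commutes], by rw [h, Algebra.commutes]⟩ }
  have hK : IsClosed (K : Set A) :=
    (isClosed_eq (by fun_prop) (F.continuous_theta.mul continuous_const)).inter
      (isClosed_eq (by fun_prop) (F.continuous_theta.mul continuous_const))
  refine F.localAlgebra_subset_of_isClosed hK (fun j hj => ?_) (fun j hj => ?_) hx
  · have hij : i ≠ j := (ne_of_mem_of_not_mem hj hi).symm
    exact ⟨by rw [theta_ann, neg_mul, ann_mul_ann], by rw [theta_ann, neg_mul, F.cre_mul_ann hij]⟩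
  · have hij : i ≠ j := (ne_of_mem_of_not_mem hj hi).symm
    exact ⟨by rw [theta_star_ann, neg_mul, F.ann_mul_cre hij],
      by rw [theta_star_ann, neg_mul, cre_mul_cre]⟩

/-- The self-adjoint unitary `a i + star (a i)`. -/
def majorana (i : Fin ν → ℤ) : A := F.a i + star (F.a i)

theorem cre_sq (i : Fin ν → ℤ) : star (F.a i) * star (F.a i) = 0 := by
  rw [← star_mul, ann_sq, star_zero]

theorem number_add_hole (i : Fin ν → ℤ) : star (F.a i) * F.a i + F.a i * star (F.a i) = 1 := by
  rw [F.car_star, if_pos rfl]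

theorem majorana_mul_self (i : Fin ν → ℤ) : F.majorana i * F.majorana i = 1 := by
  rw [← F.number_add_hole i, majorana, add_mul, mul_add, mul_add, ann_sq, cre_sq]
  abel

theorem norm_conj_of_sq {u : A} (hs : star u = u) (h : u * u = 1) (x : A) : ‖u * x * u‖ = ‖x‖ := by
  have hu : u ∈ unitary A := by
    rw [Unitary.mem_iff, hs]; exact ⟨h, h⟩
  rw [CStarRing.norm_mul_mem_unitary _ hu, CStarRing.norm_mem_unitary_mul _ hu]

theorem majorana_star (i : Fin ν → ℤ) : star (F.majorana i) = F.majorana i := by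
  rw [majorana, star_add, star_star, add_comm]

theorem GradedCommute.majorana_conj_theta {F : FermionAlgebra ν A} {i : Fin ν → ℤ} {x : A}
    (h : F.GradedCommute i x) : F.majorana i * x * F.majorana i = F.theta x := by
  have h1 : F.majorana i * x = F.theta x * F.majorana i := by
    rw [majorana, add_mul, mul_add, h.1, h.2]
  rw [h1, mul_assoc, majorana_mul_self, mul_one]

theorem GradedCommute.theta {F : FermionAlgebra ν A} {i : Fin ν → ℤ} {x : A}
    (h : F.GradedCommute i x) : F.GradedCommute i (F.theta x) := by
  have h1 := congrArg F.theta h.1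
  have h2 := congrArg F.theta h.2
  rw [map_mul, map_mul, theta_ann, neg_mul, mul_neg, neg_inj] at h1
  rw [map_mul, map_mul, theta_star_ann, neg_mul, mul_neg, neg_inj] at h2
  exact ⟨h1, h2⟩

/-- `v_i` is quadratic in the generators at `i`, so moving it past `x` applies `Θ` twice. -/
theorem GradedCommute.vSite_conj {F : FermionAlgebra ν A} {i : Fin ν → ℤ} {x : A}
    (h : F.GradedCommute i x) : F.vSite i * x * F.vSite i = x := by
  have h' := h.theta
  simp only [GradedCommute, theta_theta] at h'
  have h1 : F.vSite i * x = x * F.vSite i := by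
    rw [vSite, sub_mul, mul_sub, mul_assoc, mul_assoc, h.1, h.2, ← mul_assoc, ← mul_assoc, h'.1,
      h'.2, mul_assoc, mul_assoc]
  rw [h1, mul_assoc, vSite_mul_self, mul_one]

/-! ### Averaging out one site -/

/-- The projection of norm one of `A` onto the subalgebra of those elements which graded-commute
with `a i` and its adjoint. -/
noncomputable def siteExpectation (i : Fin ν → ℤ) : A →ₗ[ℂ] A where
  toFun x := (4⁻¹ : ℂ) • ((x + F.vSite i * x * F.vSite i) +
    F.majorana i * F.theta (x + F.vSite i * x * F.vSite i) * F.majorana i)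
  map_add' x y := by simp only [mul_add, add_mul, map_add, ← smul_add]; congr 1; abel
  map_smul' r x := by
    simp only [mul_smul_comm, smul_mul_assoc, ← smul_add, map_smul, RingHom.id_apply]
    rw [smul_comm]

theorem siteExpectation_apply (i : Fin ν → ℤ) (x : A) :
    F.siteExpectation i x = (4⁻¹ : ℂ) • ((x + F.vSite i * x * F.vSite i) +
    F.majorana i * F.theta (x + F.vSite i * x * F.vSite i) * F.majorana i) := rfl

theorem norm_siteExpectation_le (i : Fin ν → ℤ) (x : A) : ‖F.siteExpectation i x‖ ≤ ‖x‖ := by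
  have h1 : ‖x + F.vSite i * x * F.vSite i‖ ≤ ‖x‖ + ‖x‖ :=
    (norm_add_le _ _).trans_eq
      (by rw [norm_conj_of_sq (F.vSite_star i) (F.vSite_mul_self i)])
  rw [siteExpectation_apply, norm_smul]
  have h2 := norm_add_le (x + F.vSite i * x * F.vSite i)
    (F.majorana i * F.theta (x + F.vSite i * x * F.vSite i) * F.majorana i)
  rw [norm_conj_of_sq (F.majorana_star i) (F.majorana_mul_self i), norm_theta] at h2
  have h3 : ‖(4⁻¹ : ℂ)‖ = 4⁻¹ := by simp
  rw [h3]
  linarith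

theorem continuous_siteExpectation (i : Fin ν → ℤ) : Continuous (F.siteExpectation i) := by
  have h := F.continuous_theta
  simp only [siteExpectation, LinearMap.coe_mk, AddHom.coe_mk]
  fun_prop

theorem GradedCommute.siteExpectation_eq {F : FermionAlgebra ν A} {i : Fin ν → ℤ} {x : A}
    (h : F.GradedCommute i x) : F.siteExpectation i x = x := by
  rw [siteExpectation_apply, h.vSite_conj, map_add, mul_add, add_mul, h.theta.majorana_conj_theta,
    theta_theta]
  module

/-- `b` commutes with `v_i`, and the `Θ` in the last two terms of the average cancels the one
produced by moving `b` past `majorana i`. -/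
theorem siteExpectation_mul_of_mem {J : Set (Fin ν → ℤ)} {i : Fin ν → ℤ} (hi : i ∉ J)
    {b : A} (hb : b ∈ F.localAlgebra J) (x : A) :
    F.siteExpectation i (b * x) = b * F.siteExpectation i x := by
  have h := F.gradedCommute_of_mem_localAlgebra hi hb
  have hm : F.majorana i * F.theta b = b * F.majorana i := by
    have := h.theta
    simp only [GradedCommute, theta_theta] at this
    rw [majorana, add_mul, mul_add, this.1, this.2]
  have hv : F.vSite i * b = b * F.vSite i := by
    have := congrArg (· * F.vSite i) h.vSite_conj
    simpa only [mul_assoc, vSite_mul_self, mul_one] using this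
  have h1 : b * x + F.vSite i * (b * x) * F.vSite i = b * (x + F.vSite i * x * F.vSite i) := by
    rw [← mul_assoc (F.vSite i), hv]
    noncomm_ring
  rw [siteExpectation_apply, siteExpectation_apply, h1, map_mul, ← mul_assoc (F.majorana i), hm,
    mul_smul_comm, mul_add b _ (F.majorana i * _ * _)]
  simp only [mul_assoc]

theorem siteExpectation_one (i : Fin ν → ℤ) : F.siteExpectation i 1 = 1 :=
  GradedCommute.siteExpectation_eq ⟨by simp, by simp⟩

theorem siteExpectation_ann (i : Fin ν → ℤ) : F.siteExpectation i (F.a i) = 0 := by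
  have h : F.vSite i * F.a i * F.vSite i = -F.a i := by
    rw [vSite_anti, neg_mul, mul_assoc, vSite_mul_self, mul_one]
  simp [siteExpectation_apply, h]

theorem siteExpectation_cre (i : Fin ν → ℤ) : F.siteExpectation i (star (F.a i)) = 0 := by
  have h : F.vSite i * F.a i * F.vSite i = -F.a i := by
    rw [vSite_anti, neg_mul, mul_assoc, vSite_mul_self, mul_one]
  have h' : F.vSite i * star (F.a i) * F.vSite i = -star (F.a i) := by
    simpa [vSite_star, mul_assoc] using congrArg star h
  simp [siteExpectation_apply, h']

theorem siteExpectation_number (i : Fin ν → ℤ) :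
    F.siteExpectation i (star (F.a i) * F.a i) = (2⁻¹ : ℂ) • 1 := by
  have h : F.vSite i * F.a i * F.vSite i = -F.a i := by
    rw [vSite_anti, neg_mul, mul_assoc, vSite_mul_self, mul_one]
  have h' : F.vSite i * star (F.a i) * F.vSite i = -star (F.a i) := by
    simpa [vSite_star, mul_assoc] using congrArg star h
  have h2 : F.vSite i * (star (F.a i) * F.a i) * F.vSite i = star (F.a i) * F.a i := by
    calc _ = (F.vSite i * star (F.a i) * F.vSite i) * (F.vSite i * F.a i * F.vSite i) := by
          have := F.vSite_mul_self i
          grind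
      _ = _ := by rw [h, h', neg_mul_neg]
  -- Conjugation by `majorana i` exchanges the occupied and empty projections, which sum to `1`;
  -- hence the average `1/2`.
  have h3 : F.majorana i * (star (F.a i) * F.a i) * F.majorana i = F.a i * star (F.a i) := by
    have h0 : F.majorana i * (star (F.a i) * F.a i) * F.majorana i =
        F.a i * star (F.a i) * (F.a i * F.a i) + F.a i * (star (F.a i) * F.a i) * star (F.a i) +
        star (F.a i) * star (F.a i) * (F.a i * F.majorana i) := by
      unfold majorana; noncomm_ring
    rw [h0, ann_sq, cre_sq, eq_sub_of_add_eq (F.number_add_hole i), mul_sub, ← mul_assoc, ann_sq]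
    simp
  rw [siteExpectation_apply, h2, map_add, mul_add, add_mul, map_mul, theta_ann, theta_star_ann,
    neg_mul_neg, h3, ← F.number_add_hole i]
  module

theorem siteExpectation_mem {J : Set (Fin ν → ℤ)} {i : Fin ν → ℤ} {x : A}
    (hx : x ∈ F.localAlgebra J) : F.siteExpectation i x ∈ F.localAlgebra (J \ {i}) := by
  set B := F.localAlgebra (J \ {i})
  have hi : i ∉ J \ {i} := fun h => h.2 rfl
  let B' : Submodule ℂ A := Subalgebra.toSubmodule B.toSubalgebra
  let L (c : A) : Submodule ℂ A :=
    B'.comap ((F.siteExpectation i).comp (LinearMap.mulLeft ℂ c))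
  have hL : ∀ c z, z ∈ L c ↔ F.siteExpectation i (c * z) ∈ B := fun c z => Iff.rfl
  -- The four left factors span the algebra of the site `i`, so `W` is stable under left
  -- multiplication by it.
  let W : Submodule ℂ A := L 1 ⊓ L (F.a i) ⊓ L (star (F.a i)) ⊓ L (star (F.a i) * F.a i)
  have hW : ∀ z, z ∈ W ↔ F.siteExpectation i z ∈ B ∧ F.siteExpectation i (F.a i * z) ∈ B ∧
      F.siteExpectation i (star (F.a i) * z) ∈ B ∧
      F.siteExpectation i (star (F.a i) * F.a i * z) ∈ B := fun z => by
    simp only [W, Submodule.mem_inf, hL, one_mul, and_assoc]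
  have hWc : IsClosed (W : Set A) := by
    have h : ∀ c, IsClosed (L c : Set A) := fun c =>
      (F.isClosed_localAlgebra _).preimage
        ((F.continuous_siteExpectation i).comp (continuous_const_mul c))
    exact (((h _).inter (h _)).inter (h _)).inter (h _)
  -- The left multipliers of `W` form a closed subalgebra. Once it contains the generators of
  -- `A(J)`, applying `x` to `1 ∈ W` gives the claim.
  let K : Subalgebra ℂ A :=
    { carrier := {w | ∀ z ∈ W, w * z ∈ W}
      mul_mem' := fun {x y} hx hy z hz => by
        rw [mul_assoc]; exact hx _ (hy _ hz)
      add_mem' := fun {x y} hx hy z hz => by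
        rw [add_mul]; exact W.add_mem (hx _ hz) (hy _ hz)
      algebraMap_mem' := fun r z hz => by
        rw [← Algebra.smul_def]; exact W.smul_mem r hz }
  have hK : IsClosed (K : Set A) := by
    have : (K : Set A) = ⋂ z ∈ W, (fun w => w * z) ⁻¹' (W : Set A) := by
      ext w; simp [K]
    rw [this]
    exact isClosed_biInter fun z _ => hWc.preimage (continuous_mul_const z)
  have hone : (1 : A) ∈ W := by
    rw [hW]
    simp only [mul_one, siteExpectation_one, siteExpectation_ann, siteExpectation_cre,
      siteExpectation_number]
    exact ⟨one_mem _, zero_mem _, zero_mem _, B.toSubalgebra.smul_mem (one_mem B) _⟩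
  have hself : F.a i ∈ K := fun z hz => by
    obtain ⟨_, h2, _, h4⟩ := (hW z).1 hz
    rw [hW]
    refine ⟨h2, ?_, by rwa [← mul_assoc], ?_⟩
    · rw [← mul_assoc, ann_sq, zero_mul, map_zero]; exact zero_mem _
    · rw [← mul_assoc, mul_assoc (star (F.a i)), ann_sq, mul_zero, zero_mul, map_zero]
      exact zero_mem _
  have hself' : star (F.a i) ∈ K := fun z hz => by
    obtain ⟨h1, _, h3, h4⟩ := (hW z).1 hz
    rw [hW]
    refine ⟨h3, ?_, ?_, ?_⟩
    · rw [← mul_assoc, eq_sub_of_add_eq' (F.number_add_hole i), sub_mul, one_mul, map_sub]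
      exact sub_mem h1 h4
    · rw [← mul_assoc, cre_sq, zero_mul, map_zero]; exact zero_mem _
    · rw [← mul_assoc, mul_assoc (star (F.a i)), eq_sub_of_add_eq' (F.number_add_hole i), mul_sub,
        ← mul_assoc, cre_sq, zero_mul, mul_one, sub_zero]
      exact h3
  -- A generator at another site moves to the left of each of the four factors up to sign, then out
  -- of the expectation.
  have hother : ∀ b ∈ B, F.a i * b = -(b * F.a i) → star (F.a i) * b = -(b * star (F.a i)) →
      b ∈ K := fun b hb e1 e2 z hz => by
    obtain ⟨h1, h2, h3, h4⟩ := (hW z).1 hz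
    rw [hW]
    refine ⟨?_, ?_, ?_, ?_⟩
    · rw [F.siteExpectation_mul_of_mem hi hb]; exact mul_mem hb h1
    · rw [← mul_assoc, e1, neg_mul, map_neg, mul_assoc, F.siteExpectation_mul_of_mem hi hb]
      exact neg_mem (mul_mem hb h2)
    · rw [← mul_assoc, e2, neg_mul, map_neg, mul_assoc, F.siteExpectation_mul_of_mem hi hb]
      exact neg_mem (mul_mem hb h3)
    · have e3 : star (F.a i) * F.a i * b = b * (star (F.a i) * F.a i) := by
        rw [mul_assoc, e1, mul_neg, ← mul_assoc, e2, neg_mul, neg_neg, mul_assoc]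
      rw [← mul_assoc, e3, mul_assoc, F.siteExpectation_mul_of_mem hi hb]
      exact mul_mem hb h4
  have hxK : x ∈ K := by
    refine F.localAlgebra_subset_of_isClosed hK (fun j hj => ?_) (fun j hj => ?_) hx
    · by_cases hji : j = i
      · exact hji ▸ hself
      · exact hother _ (F.ann_mem_localAlgebra ⟨hj, hji⟩) (F.ann_mul_ann i j)
          (F.cre_mul_ann (Ne.symm hji))
    · by_cases hji : j = i
      · exact hji ▸ hself'
      · exact hother _ (star_mem (F.ann_mem_localAlgebra ⟨hj, hji⟩))
          (F.ann_mul_cre (Ne.symm hji)) (F.cre_mul_cre i j)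
  have h := hxK 1 hone
  rw [mul_one] at h
  exact ((hW x).1 h).1

/-! ### Finite-support approximation and the graded commutant -/

theorem exists_finset_mem_localAlgebra_norm_sub_lt (x : A) {ε : ℝ} (hε : 0 < ε) :
    ∃ (S : Finset (Fin ν → ℤ)) (z : A), z ∈ F.localAlgebra (S : Set (Fin ν → ℤ)) ∧ ‖x - z‖ < ε := by
  classical
  have hx : x ∈ closure (StarAlgebra.adjoin ℂ (Set.range F.a) : Set A) := by
    rw [← StarSubalgebra.topologicalClosure_coe, F.generates]; trivial
  have key : ∀ z ∈ StarAlgebra.adjoin ℂ (Set.range F.a),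
      ∃ S : Finset (Fin ν → ℤ), z ∈ F.localAlgebra (S : Set (Fin ν → ℤ)) := by
    intro z hz
    induction hz using StarAlgebra.adjoin_induction with
    | mem z hz =>
      obtain ⟨i, rfl⟩ := hz
      exact ⟨{i}, F.ann_mem_localAlgebra (by simp)⟩
    | algebraMap r => exact ⟨∅, algebraMap_mem _ r⟩
    | add z w _ _ h1 h2 =>
      obtain ⟨S, hS⟩ := h1
      obtain ⟨T, hT⟩ := h2
      exact ⟨S ∪ T, add_mem (F.localAlgebra_mono (by simp) hS) (F.localAlgebra_mono (by simp) hT)⟩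
    | mul z w _ _ h1 h2 =>
      obtain ⟨S, hS⟩ := h1
      obtain ⟨T, hT⟩ := h2
      exact ⟨S ∪ T, mul_mem (F.localAlgebra_mono (by simp) hS) (F.localAlgebra_mono (by simp) hT)⟩
    | star z _ h1 =>
      obtain ⟨S, hS⟩ := h1
      exact ⟨S, star_mem hS⟩
  obtain ⟨z, hz, hxz⟩ := Metric.mem_closure_iff.1 hx ε hε
  obtain ⟨S, hS⟩ := key z hz
  exact ⟨S, z, hS, by rwa [← dist_eq_norm]⟩

/-- Each `siteExpectation` is a contraction fixing `x`, so removing the sites of `K` from the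
support one by one never increases the distance to `x`. -/
theorem exists_mem_localAlgebra_diff_norm_sub_le {x : A} (K : Finset (Fin ν → ℤ))
    (hx : ∀ i ∈ K, F.GradedCommute i x) {J : Set (Fin ν → ℤ)} {z : A} (hz : z ∈ F.localAlgebra J) :
    ∃ y ∈ F.localAlgebra (J \ K), ‖x - y‖ ≤ ‖x - z‖ := by
  classical
  induction K using Finset.induction_on with
  | empty => exact ⟨z, by simpa using hz, le_rfl⟩
  | insert i K _ ih =>
    obtain ⟨y, hy, hxy⟩ := ih fun j hj => hx j (Finset.mem_insert_of_mem hj)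
    refine ⟨F.siteExpectation i y, ?_, le_trans ?_ hxy⟩
    · have h := F.siteExpectation_mem (i := i) hy
      rwa [Set.sdiff_sdiff, Set.union_singleton, ← Finset.coe_insert] at h
    · have h := F.norm_siteExpectation_le i (x - y)
      rwa [map_sub, (hx i (Finset.mem_insert_self i K)).siteExpectation_eq] at h

theorem mem_localAlgebra_compl_of_gradedCommute {I : Set (Fin ν → ℤ)} {x : A}
    (hx : ∀ i ∈ I, F.GradedCommute i x) : x ∈ F.localAlgebra Iᶜ := by
  classical
  rw [← SetLike.mem_coe, ← (F.isClosed_localAlgebra Iᶜ).closure_eq, Metric.mem_closure_iff]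
  intro ε hε
  obtain ⟨S, z, hz, hxz⟩ := F.exists_finset_mem_localAlgebra_norm_sub_lt x hε
  obtain ⟨y, hy, hxy⟩ := F.exists_mem_localAlgebra_diff_norm_sub_le (S.filter (· ∈ I))
    (fun i hi => hx i (Finset.mem_filter.1 hi).2) hz
  have hsub : (S : Set (Fin ν → ℤ)) \ (S.filter (· ∈ I) : Finset _) ⊆ Iᶜ := fun i hi hiI =>
    hi.2 (Finset.mem_coe.2 (Finset.mem_filter.2 ⟨hi.1, hiI⟩))
  refine ⟨y, F.localAlgebra_mono hsub hy, ?_⟩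
  rw [dist_eq_norm]
  exact hxy.trans_lt hxz

/-! ### The commutant and its parity -/

theorem theta_mem_centralizer {I : Set (Fin ν → ℤ)} {x : A}
    (hx : x ∈ Set.centralizer (F.localAlgebra I : Set A)) :
    F.theta x ∈ Set.centralizer (F.localAlgebra I : Set A) := by
  rw [mem_centralizer_localAlgebra_iff] at hx ⊢
  intro i hi
  have h1 := congrArg F.theta (hx i hi).1
  have h2 := congrArg F.theta (hx i hi).2
  rw [map_mul, map_mul, theta_ann, neg_mul, mul_neg, neg_inj] at h1
  rw [map_mul, map_mul, theta_star_ann, neg_mul, mul_neg, neg_inj] at h2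
  exact ⟨h1, h2⟩

/-- For `z` near `x` with finite support `S`, choose `i ∈ I` outside `S`: conjugation by `majorana
i` fixes `x` but sends `z` to `Θ z`. Thus `Θ z` is as close to `x` as `z` is, and also that close to
`Θ x`. -/
theorem theta_eq_self_of_mem_centralizer {I : Set (Fin ν → ℤ)} (hI : I.Infinite) {x : A}
    (hx : x ∈ Set.centralizer (F.localAlgebra I : Set A)) : F.theta x = x := by
  rw [← sub_eq_zero, ← norm_le_zero_iff]
  refine le_of_forall_pos_le_add fun ε hε => ?_
  obtain ⟨S, z, hz, hxz⟩ := F.exists_finset_mem_localAlgebra_norm_sub_lt x (half_pos hε)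
  obtain ⟨i, hi, hiS⟩ := hI.exists_notMem_finset S
  have hc := (F.gradedCommute_of_mem_localAlgebra (J := S) hiS hz).majorana_conj_theta
  have hxc : F.majorana i * x * F.majorana i = x := by
    obtain ⟨h1, h2⟩ := F.mem_centralizer_localAlgebra_iff.1 hx i hi
    have : F.majorana i * x = x * F.majorana i := by rw [majorana, add_mul, mul_add, h1, h2]
    rw [this, mul_assoc, majorana_mul_self, mul_one]
  have h1 : ‖x - F.theta z‖ = ‖x - z‖ := by
    rw [← norm_conj_of_sq (F.majorana_star i) (F.majorana_mul_self i) (x - z), mul_sub, sub_mul,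
      hxc, hc]
  have h2 : ‖F.theta x - F.theta z‖ = ‖x - z‖ := by rw [← map_sub, norm_theta]
  have h3 := norm_sub_le_norm_sub_add_norm_sub (F.theta x) (F.theta z) x
  rw [norm_sub_rev (F.theta z) x] at h3
  linarith

theorem evenPart_compl_subset_centralizer (I : Set (Fin ν → ℤ)) :
    F.evenPart Iᶜ ⊆ Set.centralizer (F.localAlgebra I : Set A) := by
  rintro x ⟨hx, hxe⟩
  rw [mem_centralizer_localAlgebra_iff]
  intro i hi
  have h := F.gradedCommute_of_mem_localAlgebra (fun h : i ∈ Iᶜ => h hi) hx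
  rwa [GradedCommute, hxe] at h

theorem ann_mul_v {I : Finset (Fin ν → ℤ)} {i : Fin ν → ℤ} (hi : i ∈ I) :
    F.a i * F.v I = -(F.v I * F.a i) := by
  have h := congrArg (F.v I * ·) (F.v_anti hi)
  simp only [← mul_assoc, (F.v_star_and_sq I).2, one_mul] at h
  rw [h, mul_neg]

theorem cre_mul_v {I : Finset (Fin ν → ℤ)} {i : Fin ν → ℤ} (hi : i ∈ I) :
    star (F.a i) * F.v I = -(F.v I * star (F.a i)) := by
  have h := congrArg star (F.ann_mul_v hi)
  rw [star_mul, star_neg, star_mul, (F.v_star_and_sq I).1] at h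
  rw [h, neg_neg]

end FermionAlgebra

theorem mainTheorem11 {ν : ℕ} {A : Type*} [CStarAlgebra A] (F : FermionAlgebra ν A) :
    (∀ I : Finset (Fin ν → ℤ),
      Set.centralizer (F.localAlgebra (I : Set (Fin ν → ℤ)) : Set A) =
        F.evenPart ((I : Set (Fin ν → ℤ))ᶜ) + F.v I • F.oddPart ((I : Set (Fin ν → ℤ))ᶜ)) ∧
    (∀ I : Set (Fin ν → ℤ), I.Infinite →
      Set.centralizer (F.localAlgebra I : Set A) = F.evenPart Iᶜ) := by
  refine ⟨fun I => Set.Subset.antisymm (fun x hx => ?_) ?_, fun I hI => Set.Subset.antisymm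
    (fun x hx => ⟨?_, F.theta_eq_self_of_mem_centralizer hI hx⟩)
    (F.evenPart_compl_subset_centralizer I)⟩
  · have hv := (F.v_star_and_sq I).2
    have hx' := F.mem_centralizer_localAlgebra_iff.1 (F.theta_mem_centralizer hx)
    rw [F.mem_centralizer_localAlgebra_iff] at hx
    have he : F.theta ((2⁻¹ : ℂ) • (x + F.theta x)) = (2⁻¹ : ℂ) • (x + F.theta x) := by
      rw [map_smul, map_add, F.theta_theta, add_comm]
    have ho : F.theta (F.v I * ((2⁻¹ : ℂ) • (x - F.theta x))) =
        -(F.v I * ((2⁻¹ : ℂ) • (x - F.theta x))) := by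
      rw [map_mul, F.theta_v, map_smul, map_sub, F.theta_theta, ← mul_neg, ← smul_neg, neg_sub]
    -- The witnesses are the even part of `x` and `v_I` times its odd part; `v_I ^ 2 = 1` recovers
    -- `x`.
    refine Set.mem_add.2 ⟨(2⁻¹ : ℂ) • (x + F.theta x),
      ⟨F.mem_localAlgebra_compl_of_gradedCommute fun i hi => ?_, he⟩, _,
      Set.smul_mem_smul_set (a := F.v I) (b := F.v I * ((2⁻¹ : ℂ) • (x - F.theta x)))
      ⟨F.mem_localAlgebra_compl_of_gradedCommute fun i hi => ?_, ho⟩, ?_⟩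
    · rw [FermionAlgebra.GradedCommute, he]
      simp only [mul_smul_comm, smul_mul_assoc, mul_add, add_mul, hx i hi, hx' i hi, and_self]
    · rw [FermionAlgebra.GradedCommute, ho, ← mul_assoc, ← mul_assoc, F.ann_mul_v hi,
        F.cre_mul_v hi]
      simp only [neg_mul, mul_assoc, mul_smul_comm, smul_mul_assoc, mul_sub, sub_mul, hx i hi,
        hx' i hi]
      constructor <;> module
    · rw [smul_eq_mul, ← mul_assoc, hv, one_mul]
      module
  · rintro _ ⟨p, hp, _, ⟨q, ⟨hq, hqo⟩, rfl⟩, rfl⟩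
    refine Set.add_mem_centralizer (F.evenPart_compl_subset_centralizer _ hp) ?_
    rw [F.mem_centralizer_localAlgebra_iff]
    intro i hi
    have h := F.gradedCommute_of_mem_localAlgebra
      (fun h : i ∈ ((I : Set (Fin ν → ℤ))ᶜ) => h hi) hq
    rw [FermionAlgebra.GradedCommute, hqo] at h
    simp only [smul_eq_mul]
    -- The sign from passing `v_I` cancels the sign from passing the odd `q`.
    rw [← mul_assoc, ← mul_assoc, F.ann_mul_v hi, F.cre_mul_v hi]
    simp only [mul_assoc, h.1, h.2, neg_mul, mul_neg, neg_neg, and_self]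
  · refine F.mem_localAlgebra_compl_of_gradedCommute fun i hi => ?_
    rw [FermionAlgebra.GradedCommute, F.theta_eq_self_of_mem_centralizer hI hx]
    exact F.mem_centralizer_localAlgebra_iff.1 hx i hi
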